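/- **Conventions.** Languages are computable and relational. A computable $\Sigma_1$ formula is a disjunction, over a computably enumerable set, of finitary existential formulas in a fixed finite tuple of free variables. A generalized computable $\Sigma_1$ definition (without parameters) of a relation $R$ on finite tuples from a structure $\mathcal{B}$ is a computable family of computable $\Sigma_1$ formulas, one for each possible choice of lengths of the tuples, each of which defines the part of $R$ on tuples of these lengths. An effective interpretation of $\mathcal{A}=(A,(R_i)_i)$ in $\mathcal{B}$ consists of a set $D\subseteq\mathcal{B}^{<\omega}$, an equivalence relation $\sim$ on $D$ and $\sim$-invariant relations $R_i^*$ on $D$ with $(D,(R_i^*)_i)/{\sim}\cong\mathcal{A}$, such that $D$, $\sim$, $\not\sim$, all $R_i^*$ and all complements $\neg R_i^*$ (within $D$) are defined, without parameters, by a computable sequence of generalized computable $\Sigma_1$ formulas. Write $\mathcal{A}^{\mathcal{B}}$ for the copy of $\mathcal{A}$ obtained from these formulas in $\mathcal{B}$. The structures $\mathcal{A}$ and $\mathcal{B}$ are *effectively bi-interpretable* if there are effective interpretations of $\mathcal{A}$ in $\mathcal{B}$ and of $\mathcal{B}$ in $\mathcal{A}$ and isomorphisms $f:\mathcal{A}\to\mathcal{A}^{\mathcal{B}^{\mathcal{A}}}$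 and $g:\mathcal{B}\to\mathcal{B}^{\mathcal{A}^{\mathcal{B}}}$ such that the relations $R_f$ and $R_g$ have generalized computable $\Sigma_1$ definitions without parameters; here $R_f$ holds of $a,\bar a_1,\dots,\bar a_r$ iff $f(a)$ is the class of the tuple of the classes of $\bar a_1,\dots,\bar a_r$, and $R_g$ is defined in the same way. For a field $F$, regarded as a structure with the graphs of $+$ and $\cdot$, let $H(F)$ be its Heisenberg group, that is, the group of upper triangular $3\times3$ matrices over $F$ with $1$'s on the diagonal, regarded as a structure with the graph of its multiplication. **Theorem.** 1. There is no single system of formulas that, for all countable fields $F$ simultaneously, witnesses that $F$ and $H(F)$ are effectively bi-interpretable; that is, $F$ and $H(F)$ are not uniformly effectively bi-interpretable. 2. $\mathbb{Q}$ and $H(\mathbb{Q})$ are not effectively bi-interpretable. 3. The field $\mathbb{Q}$ is rigid: its only automorphism is the identity. 4. The group $H(\mathbb{Q})$ has a nontrivial automorphism. In fact, for every non-commuting pair $u,v\in H(\mathbb{Q})$ there is an automorphism of $H(\mathbb{Q})$ that takes $u$ to $v$ and $v$ to $u$. 5. If two structures $\mathcal{A}$ and $\mathcal{B}$ for computable relational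 languages are effectively bi-interpretable, then the groups $\mathrm{Aut}(\mathcal{A})$ and $\mathrm{Aut}(\mathcal{B})$ are isomorphic. -/

import Mathlib

open scoped FirstOrder

/-! ### Generalized computable `Σ₁` formulas -/

/-- A computable relational language: the relation symbols are effectively coded by natural
numbers, and the arity of a symbol is computable from its code. -/
class ComputableLanguage (L : FirstOrder.Language.{0, 0}) extends Primcodable (Σ n, L.Relations n) where
  relational : L.IsRelational
  arity_computable : Computable (fun r : (Σ n, L.Relations n) => r.1)

attribute [instance] ComputableLanguage.relational

/-- Code of a term of a relational language; such a term is a variable (free or bound). -/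
def codeTerm {L : FirstOrder.Language.{0, 0}} [ComputableLanguage L] {m k : ℕ} :
    L.Term (Fin m ⊕ Fin k) → ℕ
  | .var x => Encodable.encode x
  | .func f _ => isEmptyElim f

/-- The Gödel number of a finitary formula with free variables `Fin m`
and `k` further variables. -/
def codeFormula {L : FirstOrder.Language.{0, 0}} [ComputableLanguage L] {m : ℕ} :
    ∀ {k : ℕ}, L.BoundedFormula (Fin m) k → ℕ
  | _, .falsum => Nat.pair 0 0
  | _, .equal t₁ t₂ => Nat.pair 1 (Nat.pair (codeTerm t₁) (codeTerm t₂))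
  | _, .rel (l := l) R ts => Nat.pair 2 (Nat.pair
      (Encodable.encode (⟨l, R⟩ : Σ n, L.Relations n))
      (Encodable.encode (List.ofFn fun i => codeTerm (ts i))))
  | _, .imp φ ψ => Nat.pair 3 (Nat.pair (codeFormula φ) (codeFormula ψ))
  | _, .all φ => Nat.pair 4 (codeFormula φ)

/-- A computable sequence, indexed by `J`, of generalized computable `Σ₁` formulas without
parameters, each defining a relation on `B^{<ω}` of finite, possibly varying, arity.

An argument is a finite sequence of tuples `(b̄₁, …, b̄ᵣ)`; its shape is the list `s` of the lengths
of the `b̄ᵢ`. For every index `j` and shape `s` there is a computable `Σ₁` formula in `s.sum` free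
variables, namely the disjunction over `k` and over the `ψ ∈ disj j s k` of `∃ y₁ … y_k, ψ`, with
`ψ` finitary and quantifier-free. Uniform computability: the set of all (codes of) such disjuncts
is computably enumerable. -/
structure SigmaOneFamily (L : FirstOrder.Language.{0, 0}) [ComputableLanguage L]
    (J : Type) [Primcodable J] where
  disj : (j : J) → (s : List ℕ) → (k : ℕ) → Set (L.BoundedFormula (Fin s.sum) k)
  isQF : ∀ j s k, ∀ ψ ∈ disj j s k, ψ.IsQF
  re : REPred fun p : J × List ℕ × ℕ × ℕ =>
    ∃ ψ ∈ disj p.1 p.2.1 p.2.2.1, codeFormula ψ = p.2.2.2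

/-- The concatenation of a finite sequence of tuples, as a valuation of the free variables. -/
def tupleEntries {B : Type} (t : List (List B)) (i : Fin (t.map List.length).sum) : B :=
  t.flatten.get (i.cast List.length_flatten.symm)

/-- The `j`-th formula of the family holds in `B` of the sequence of tuples `t`. -/
def SigmaOneFamily.Holds {L : FirstOrder.Language.{0, 0}} [ComputableLanguage L] {J : Type} [Primcodable J]
    (Φ : SigmaOneFamily L J) {B : Type} [L.Structure B] (j : J) (t : List (List B)) : Prop :=
  ∃ k, ∃ ψ ∈ Φ.disj j (t.map List.length) k, ψ.exs.Realize (tupleEntries t)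

/-! ### Effective interpretations -/

/-- The formulas of an effective interpretation of `L`-structures in `L'`-structures: `L'`-formulas
for the domain `D`, for `∼` (index `true`) and `≁` (index `false`), and for each relation `R*`
(index `(true, R)`) and its complement (index `(false, R)`). -/
structure InterpFormulas (L L' : FirstOrder.Language.{0, 0}) [ComputableLanguage L]
    [ComputableLanguage L'] where
  dom : SigmaOneFamily L' Unit
  eqv : SigmaOneFamily L' Bool
  rel : SigmaOneFamily L' (Bool × (Σ n, L.Relations n))

namespace InterpFormulas

variable {L L' : FirstOrder.Language.{0, 0}} [ComputableLanguage L] [ComputableLanguage L']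

/-- The set `D` of tuples of `B` defined by the domain formula. -/
def Dom (I : InterpFormulas L L') (B : Type) [L'.Structure B] : Type :=
  {b : List B // I.dom.Holds () [b]}

/-- The universe `D/∼` of the structure defined in `B`. -/
def Carrier (I : InterpFormulas L L') (B : Type) [L'.Structure B] : Type :=
  Quot fun b c : I.Dom B => I.eqv.Holds true [b.1, c.1]

/-- The `∼`-class of an element of `D`. -/
def cls (I : InterpFormulas L L') {B : Type} [L'.Structure B] (b : I.Dom B) : I.Carrier B :=
  Quot.mk _ b

/-- The structure `(D, (R*)_R)/∼`. -/
instance (I : InterpFormulas L L') (B : Type) [L'.Structure B] : L.Structure (I.Carrier B) where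
  funMap f := isEmptyElim f
  RelMap {n} R x := ∃ d : Fin n → I.Dom B, (∀ i, I.cls (d i) = x i) ∧
    I.rel.Holds (true, ⟨n, R⟩) (List.ofFn fun i => (d i).1)

/-- In `B`, the formulas define `D`, relations `∼` and `R*` on `D` and their complements on `D`,
where `∼` is an equivalence relation with which all `R*` are compatible. -/
structure WellDefined (I : InterpFormulas L L') (B : Type) [L'.Structure B] : Prop where
  eqv_dom : ∀ (s : Bool) (b c : List B), I.eqv.Holds s [b, c] →
    I.dom.Holds () [b] ∧ I.dom.Holds () [c]
  eqv_equivalence : Equivalence fun b c : I.Dom B => I.eqv.Holds true [b.1, c.1]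
  eqv_compl : ∀ b c : I.Dom B, I.eqv.Holds false [b.1, c.1] ↔ ¬ I.eqv.Holds true [b.1, c.1]
  rel_dom : ∀ (s : Bool) (n : ℕ) (R : L.Relations n) (d : Fin n → List B),
    I.rel.Holds (s, ⟨n, R⟩) (List.ofFn d) → ∀ i, I.dom.Holds () [d i]
  rel_congr : ∀ (n : ℕ) (R : L.Relations n) (d e : Fin n → I.Dom B),
    (∀ i, I.eqv.Holds true [(d i).1, (e i).1]) →
    I.rel.Holds (true, ⟨n, R⟩) (List.ofFn fun i => (d i).1) →
    I.rel.Holds (true, ⟨n, R⟩) (List.ofFn fun i => (e i).1)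
  rel_compl : ∀ (n : ℕ) (R : L.Relations n) (d : Fin n → I.Dom B),
    I.rel.Holds (false, ⟨n, R⟩) (List.ofFn fun i => (d i).1) ↔
      ¬ I.rel.Holds (true, ⟨n, R⟩) (List.ofFn fun i => (d i).1)

/-- The formulas define an effective interpretation of `A` in `B`. -/
def Interprets (I : InterpFormulas L L') (A B : Type) [L.Structure A] [L'.Structure B] : Prop :=
  I.WellDefined B ∧ Nonempty (A ≃[L] I.Carrier B)

/-- The formula `Φ` defines the relation representing the isomorphism `f : A ≅ A^(B^A)`, where
`B^A = J.Carrier A`: it holds of `a, ā₁, …, āᵣ` iff the `āᵢ` represent elements of `B^A`, the tuple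
of these elements represents an element of `A^(B^A)`, and this element is `f a`. -/
def DefinesIso (I : InterpFormulas L L') (J : InterpFormulas L' L) {A : Type} [L.Structure A]
    (Φ : SigmaOneFamily L Unit) (f : A ≃[L] I.Carrier (J.Carrier A)) : Prop :=
  ∀ (a : A) (l : List (List A)), Φ.Holds () ([a] :: l) ↔
    ∃ d : List (J.Dom A), d.map (fun x => x.1) = l ∧
      ∃ h : I.dom.Holds () [d.map J.cls], f a = I.cls ⟨d.map J.cls, h⟩

end InterpFormulas

/-! ### Effective bi-interpretability -/

/-- The formulas `I`, `J`, `Φ`, `Ψ` witness that `A` and `B` are effectively bi-interpretable: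
`I` interprets `A` in `B`, `J` interprets `B` in `A`, and `Φ`, `Ψ` define isomorphisms
`A ≅ A^(B^A)` and `B ≅ B^(A^B)`. -/
def BiInterpretsVia {L L' : FirstOrder.Language.{0, 0}} [ComputableLanguage L] [ComputableLanguage L']
    (I : InterpFormulas L L') (J : InterpFormulas L' L)
    (Φ : SigmaOneFamily L Unit) (Ψ : SigmaOneFamily L' Unit)
    (A B : Type) [L.Structure A] [L'.Structure B] : Prop :=
  I.Interprets A B ∧ J.Interprets B A ∧
    (∃ f : A ≃[L] I.Carrier (J.Carrier A), I.DefinesIso J Φ f) ∧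
    (∃ g : B ≃[L'] J.Carrier (I.Carrier B), J.DefinesIso I Ψ g)

/-- The structures `A` and `B` are effectively bi-interpretable. -/
def EffectivelyBiInterpretable (L L' : FirstOrder.Language.{0, 0}) [ComputableLanguage L]
    [ComputableLanguage L'] (A B : Type) [L.Structure A] [L'.Structure B] : Prop :=
  ∃ (I : InterpFormulas L L') (J : InterpFormulas L' L)
    (Φ : SigmaOneFamily L Unit) (Ψ : SigmaOneFamily L' Unit), BiInterpretsVia I J Φ Ψ A B

/-- The automorphism groups of `A` and `B` are isomorphic. -/
def AutIsomorphic (L L' : FirstOrder.Language.{0, 0}) (A B : Type) [L.Structure A] [L'.Structure B] : Prop :=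
  ∃ e : (A ≃[L] A) ≃ (B ≃[L'] B), ∀ σ τ, e (σ.comp τ) = (e σ).comp (e τ)

/-! ### Fields and groups as relational structures -/

/-- The relation symbols for fields: the graphs of addition and multiplication. -/
inductive FieldRel : ℕ → Type
  | add : FieldRel 3
  | mul : FieldRel 3

/-- The relational language of fields. -/
def fieldLang : FirstOrder.Language.{0, 0} := ⟨fun _ => Empty, FieldRel⟩

/-- The relation symbols for fields are coded by the two booleans. -/
def fieldRelEquiv : (Σ n, fieldLang.Relations n) ≃ Bool where
  toFun r := match r with
    | ⟨_, FieldRel.add⟩ => false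
    | ⟨_, FieldRel.mul⟩ => true
  invFun b := match b with
    | false => ⟨3, FieldRel.add⟩
    | true => ⟨3, FieldRel.mul⟩
  left_inv := by rintro ⟨_, r⟩; cases r <;> rfl
  right_inv := by rintro (_ | _) <;> rfl

instance : ComputableLanguage fieldLang where
  toPrimcodable := Primcodable.ofEquiv Bool fieldRelEquiv
  relational := fun _ => inferInstanceAs (IsEmpty Empty)
  arity_computable := by
    let _ : Primcodable (Σ n, fieldLang.Relations n) := Primcodable.ofEquiv Bool fieldRelEquiv
    refine (Computable.const 3).of_eq ?_
    rintro ⟨_, r⟩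
    cases r <;> rfl

/-- A field as a structure for the relational language of fields. -/
instance (F : Type) [Field F] : fieldLang.Structure F where
  funMap f := isEmptyElim f
  RelMap R x := match R with
    | FieldRel.add => x 0 + x 1 = x 2
    | FieldRel.mul => x 0 * x 1 = x 2

/-- The relation symbol for groups: the graph of multiplication. -/
inductive GroupRel : ℕ → Type
  | mul : GroupRel 3

/-- The relational language of groups. -/
def groupLang : FirstOrder.Language.{0, 0} := ⟨fun _ => Empty, GroupRel⟩

/-- There is exactly one relation symbol for groups. -/
def groupRelEquiv : (Σ n, groupLang.Relations n) ≃ Unit where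
  toFun _ := ()
  invFun _ := ⟨3, GroupRel.mul⟩
  left_inv := by rintro ⟨_, r⟩; cases r; rfl
  right_inv _ := rfl

instance : ComputableLanguage groupLang where
  toPrimcodable := Primcodable.ofEquiv Unit groupRelEquiv
  relational := fun _ => inferInstanceAs (IsEmpty Empty)
  arity_computable := by
    let _ : Primcodable (Σ n, groupLang.Relations n) := Primcodable.ofEquiv Unit groupRelEquiv
    refine (Computable.const 3).of_eq ?_
    rintro ⟨_, r⟩
    cases r
    rfl

/-- A group as a structure for the relational language of groups. -/
instance (G : Type) [Group G] : groupLang.Structure G where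
  funMap f := isEmptyElim f
  RelMap R x := match R with
    | GroupRel.mul => x 0 * x 1 = x 2

/-! ### The Heisenberg group -/

/-- The Heisenberg group `H(F)`: the matrices `!![1, a, c; 0, 1, b; 0, 0, 1]` in `GL₃(F)`. -/
def Heisenberg (F : Type) [Field F] : Subgroup (GL (Fin 3) F) where
  carrier := {g | ∃ a b c : F, (g : Matrix (Fin 3) (Fin 3) F) = !![1, a, c; 0, 1, b; 0, 0, 1]}
  one_mem' := ⟨0, 0, 0, by ext i j; fin_cases i <;> fin_cases j <;> simp⟩
  mul_mem' := by
    rintro g g' ⟨a, b, c, h⟩ ⟨a', b', c', h'⟩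
    refine ⟨a + a', b + b', c + c' + a * b', ?_⟩
    rw [Units.val_mul, h, h']
    ext i j
    fin_cases i <;> fin_cases j <;> simp [Matrix.mul_apply, Fin.sum_univ_three] <;> ring
  inv_mem' := by
    rintro g ⟨a, b, c, h⟩
    refine ⟨-a, -b, a * b - c, ?_⟩
    refine Units.inv_eq_of_mul_eq_one_right ?_
    rw [h]
    ext i j
    fin_cases i <;> fin_cases j <;> simp [Matrix.mul_apply, Fin.sum_univ_three]
    ring

/-- There is one system of formulas witnessing, for all countable fields `F` simultaneously, that
`F` and `H(F)` are effectively bi-interpretable. -/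
def UniformlyEffectivelyBiInterpretableHeisenberg : Prop :=
  ∃ (I : InterpFormulas fieldLang groupLang) (J : InterpFormulas groupLang fieldLang)
    (Φ : SigmaOneFamily fieldLang Unit) (Ψ : SigmaOneFamily groupLang Unit),
    ∀ (F : Type) [Field F] [Countable F], BiInterpretsVia I J Φ Ψ F (Heisenberg F)

/-!
A parameter-free `Σ₁` formula is preserved by isomorphisms, so an interpretation `J` of `B` in `A`
is functorial: every `σ ∈ Aut(A)` induces `J.map σ ∈ Aut(B^A)`. The isomorphism `f : A ≅ A^(B^A)`
of a bi-interpretation is itself definable without parameters, hence natural,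
`f ∘ σ = I.map (J.map σ) ∘ f`. So `J.map` is injective on `Aut(A)` and, by the symmetric argument,
`I.map` is injective on `Aut(B) ≅ Aut(B^A)`. Every `ρ ∈ Aut(B^A)` is then induced by
`f⁻¹ ∘ I.map ρ ∘ f`, both sides having the same image under `I.map`. Therefore `Aut(A) ≅ Aut(B)`.

A rigid field such as `ℚ` thus cannot be effectively bi-interpretable with its Heisenberg group,
which, being non-commutative, has nontrivial inner automorphisms. If `2` is invertible, the
exponential map identifies `H(F)` with the Heisenberg Lie algebra `F³`. For non-commuting `u`, `v`
the elements `log u`, `log v`, `[log u, log v]` form a basis with the same structure constants as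
the standard one, so `Aut(H(F))` is transitive on non-commuting pairs and can swap `u` and `v`.
-/

namespace SigmaOneFamily

variable {L : FirstOrder.Language.{0, 0}} [ComputableLanguage L] {J : Type} [Primcodable J]
  {B C : Type} [L.Structure B] [L.Structure C]

/- The shapes of `t` and of its image under a map agree only propositionally, so `Holds` has to be
transported between the corresponding types of formulas. -/
theorem holds_iff_of_map_length_eq (Φ : SigmaOneFamily L J) (j : J) {t : List (List B)}
    {s : List ℕ} (hs : t.map List.length = s) :
    Φ.Holds j t ↔ ∃ k, ∃ ψ ∈ Φ.disj j s k,
      ψ.exs.Realize fun i => tupleEntries t (i.cast (congrArg List.sum hs.symm)) := by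
  subst hs
  rfl

theorem Holds.map {Φ : SigmaOneFamily L J} {j : J} {t : List (List B)} (h : Φ.Holds j t)
    {F : Type*} [FunLike F B C] [EmbeddingLike F B C]
    [FirstOrder.Language.StrongHomClass L F B C] (e : F) :
    Φ.Holds j (t.map (List.map e)) := by
  obtain ⟨k, ψ, hψ, hreal⟩ := h
  have hshape : (t.map (List.map e)).map List.length = t.map List.length := by simp
  obtain ⟨ys, hys⟩ := FirstOrder.Language.BoundedFormula.realize_exs.1 hreal
  refine (Φ.holds_iff_of_map_length_eq j hshape).2
    ⟨k, ψ, hψ, FirstOrder.Language.BoundedFormula.realize_exs.2 ⟨e ∘ ys, ?_⟩⟩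
  have hentries : (fun i => tupleEntries (t.map (List.map e))
      (i.cast (congrArg List.sum hshape.symm))) = e ∘ tupleEntries t := by
    funext i
    simp [tupleEntries, ← List.map_flatten]
  rw [hentries]
  exact ((Φ.isQF j _ k ψ hψ).realize_embedding e).2 hys

end SigmaOneFamily

section AutCongr

universe u v

variable {L : FirstOrder.Language.{u, v}} {A B : Type*} [L.Structure A] [L.Structure B]

/-- Conjugation by an isomorphism, as a bijection between automorphism groups: the analogue of
`MulAut.congr` for first-order structures. -/
def autCongr (e : A ≃[L] B) : (A ≃[L] A) ≃ (B ≃[L] B) where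
  toFun σ := e.comp (σ.comp e.symm)
  invFun τ := e.symm.comp (τ.comp e)
  left_inv σ := by ext; simp
  right_inv τ := by ext; simp

theorem autCongr_apply (e : A ≃[L] B) (σ : A ≃[L] A) :
    autCongr e σ = e.comp (σ.comp e.symm) := rfl

theorem autCongr_comp (e : A ≃[L] B) (σ τ : A ≃[L] A) :
    autCongr e (σ.comp τ) = (autCongr e σ).comp (autCongr e τ) := by
  ext
  simp [autCongr_apply]

end AutCongr

namespace InterpFormulas

variable {L L' : FirstOrder.Language.{0, 0}} [ComputableLanguage L] [ComputableLanguage L']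
  (I : InterpFormulas L L') {B C D : Type} [L'.Structure B] [L'.Structure C] [L'.Structure D]

/-- The action of an isomorphism on the domain of an interpretation. -/
def mapDom (e : B ≃[L'] C) (b : I.Dom B) : I.Dom C :=
  ⟨b.1.map e, b.2.map e⟩

/-- The action of an isomorphism on the universe of the interpreted structure. -/
def mapCarrier (e : B ≃[L'] C) : I.Carrier B → I.Carrier C :=
  Quot.map (I.mapDom e) fun _ _ h => h.map e

theorem mapCarrier_refl (x : I.Carrier B) : I.mapCarrier (.refl L' B) x = x := by
  induction x using Quot.ind with
  | mk b => exact congrArg I.cls (Subtype.ext (List.map_id b.1))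

theorem mapCarrier_comp (e : C ≃[L'] D) (e' : B ≃[L'] C) (x : I.Carrier B) :
    I.mapCarrier (e.comp e') x = I.mapCarrier e (I.mapCarrier e' x) := by
  induction x using Quot.ind with
  | mk b => exact congrArg I.cls (Subtype.ext (by simp [mapDom]))

theorem mapCarrier_symm_mapCarrier (e : B ≃[L'] C) (x : I.Carrier B) :
    I.mapCarrier e.symm (I.mapCarrier e x) = x := by
  rw [← mapCarrier_comp, FirstOrder.Language.Equiv.symm_comp_self, mapCarrier_refl]

theorem mapCarrier_mapCarrier_symm (e : B ≃[L'] C) (x : I.Carrier C) :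
    I.mapCarrier e (I.mapCarrier e.symm x) = x :=
  I.mapCarrier_symm_mapCarrier e.symm x

theorem relMap_mapCarrier (e : B ≃[L'] C) {n : ℕ} {R : L.Relations n} {x : Fin n → I.Carrier B}
    (h : FirstOrder.Language.Structure.RelMap R x) :
    FirstOrder.Language.Structure.RelMap R (I.mapCarrier e ∘ x) := by
  obtain ⟨d, hdx, hR⟩ := h
  refine ⟨fun i => I.mapDom e (d i), fun i => congrArg (I.mapCarrier e) (hdx i), ?_⟩
  have hmap := hR.map e
  rw [List.map_ofFn] at hmap
  exact hmap

/-- An isomorphism of structures induces an isomorphism of the interpreted structures. -/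
def map (e : B ≃[L'] C) : I.Carrier B ≃[L] I.Carrier C where
  toFun := I.mapCarrier e
  invFun := I.mapCarrier e.symm
  left_inv := I.mapCarrier_symm_mapCarrier e
  right_inv := I.mapCarrier_mapCarrier_symm e
  map_fun' f := isEmptyElim f
  map_rel' R x := by
    refine ⟨fun h => ?_, I.relMap_mapCarrier e⟩
    simpa [Function.comp_def, mapCarrier_symm_mapCarrier] using I.relMap_mapCarrier e.symm h

theorem map_comp (e : C ≃[L'] D) (e' : B ≃[L'] C) :
    I.map (e.comp e') = (I.map e).comp (I.map e') :=
  FirstOrder.Language.Equiv.ext (I.mapCarrier_comp e e')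

theorem map_autCongr (e : B ≃[L'] C) (σ : B ≃[L'] B) :
    I.map (autCongr e σ) = autCongr (I.map e) (I.map σ) := by
  rw [autCongr_apply, map_comp, map_comp]
  rfl

theorem map_injective_of_equiv (e : B ≃[L'] C)
    (h : Function.Injective (I.map : (B ≃[L'] B) → (I.Carrier B ≃[L] I.Carrier B))) :
    Function.Injective (I.map : (C ≃[L'] C) → (I.Carrier C ≃[L] I.Carrier C)) := by
  intro ρ τ hρτ
  apply (autCongr e.symm).injective
  apply h
  rw [map_autCongr, map_autCongr, hρτ]

variable {I} {J : InterpFormulas L' L} {A : Type} [L.Structure A]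

theorem exists_eq_cls_map_cls (x : I.Carrier (J.Carrier A)) :
    ∃ (d : List (J.Dom A)) (h : I.dom.Holds () [d.map J.cls]), x = I.cls ⟨d.map J.cls, h⟩ := by
  obtain ⟨⟨y, hy⟩, rfl⟩ := Quot.exists_rep x
  obtain ⟨d, rfl⟩ := List.map_surjective_iff.2 (Quot.exists_rep (r := _)) y
  exact ⟨d, hy, rfl⟩

theorem map_map_cls_map_cls (σ : A ≃[L] A) (d : List (J.Dom A))
    (h : I.dom.Holds () [d.map J.cls]) (h' : I.dom.Holds () [(d.map (J.mapDom σ)).map J.cls]) :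
    I.map (J.map σ) (I.cls ⟨d.map J.cls, h⟩) = I.cls ⟨(d.map (J.mapDom σ)).map J.cls, h'⟩ := by
  refine congrArg I.cls (Subtype.ext ?_)
  calc (d.map J.cls).map (J.map σ) = d.map (J.cls ∘ J.mapDom σ) := List.map_map
    _ = (d.map (J.mapDom σ)).map J.cls := List.map_map.symm

namespace DefinesIso

variable {Φ : SigmaOneFamily L Unit} {f : A ≃[L] I.Carrier (J.Carrier A)}

theorem holds_iff (hf : I.DefinesIso J Φ f) (a : A) (d : List (J.Dom A)) :
    Φ.Holds () ([a] :: d.map fun x => x.1) ↔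
      ∃ h : I.dom.Holds () [d.map J.cls], f a = I.cls ⟨d.map J.cls, h⟩ := by
  have hval : Function.Injective fun x : J.Dom A => x.1 := fun _ _ => Subtype.ext
  rw [hf a]
  constructor
  · rintro ⟨d', hd', h⟩
    obtain rfl := List.map_injective_iff.2 hval hd'
    exact h
  · exact fun h => ⟨d, rfl, h⟩

theorem apply_aut (hf : I.DefinesIso J Φ f) (σ : A ≃[L] A) (a : A) :
    f (σ a) = I.map (J.map σ) (f a) := by
  obtain ⟨d, hd, hfa⟩ := exists_eq_cls_map_cls (f a)
  have hσ : Φ.Holds () ([σ a] :: (d.map (J.mapDom σ)).map fun x => x.1) := by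
    simpa [Function.comp_def, mapDom] using ((hf.holds_iff a d).2 ⟨hd, hfa⟩).map σ
  obtain ⟨h, hfσ⟩ := (hf.holds_iff _ _).1 hσ
  rw [hfσ, hfa, map_map_cls_map_cls σ d hd h]

theorem map_map (hf : I.DefinesIso J Φ f) (σ : A ≃[L] A) :
    I.map (J.map σ) = autCongr f σ := by
  ext x
  obtain ⟨a, rfl⟩ := f.surjective x
  simp [autCongr_apply, hf.apply_aut]

theorem map_injective (hf : I.DefinesIso J Φ f) :
    Function.Injective (J.map : (A ≃[L] A) → (J.Carrier A ≃[L'] J.Carrier A)) := by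
  intro σ τ hστ
  apply (autCongr f).injective
  rw [← hf.map_map, ← hf.map_map, hστ]

theorem map_bijective (hf : I.DefinesIso J Φ f)
    (hI : Function.Injective
      (I.map : (J.Carrier A ≃[L'] J.Carrier A) → (I.Carrier (J.Carrier A) ≃[L] _))) :
    Function.Bijective (J.map : (A ≃[L] A) → (J.Carrier A ≃[L'] J.Carrier A)) := by
  refine ⟨hf.map_injective, fun ρ => ⟨(autCongr f).symm (I.map ρ), hI ?_⟩⟩
  rw [hf.map_map, Equiv.apply_symm_apply]

end DefinesIso

end InterpFormulas

theorem EffectivelyBiInterpretable.autIsomorphic {L L' : FirstOrder.Language.{0, 0}}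
    [ComputableLanguage L] [ComputableLanguage L'] {A B : Type} [L.Structure A] [L'.Structure B]
    (h : EffectivelyBiInterpretable L L' A B) : AutIsomorphic L L' A B := by
  obtain ⟨I, J, Φ, Ψ, -, ⟨-, ⟨β⟩⟩, ⟨f, hf⟩, ⟨g, hg⟩⟩ := h
  have hJ := hf.map_bijective (I.map_injective_of_equiv β hg.map_injective)
  refine ⟨(Equiv.ofBijective J.map hJ).trans (autCongr β.symm), fun σ τ => ?_⟩
  simp only [Equiv.trans_apply, Equiv.ofBijective_apply, J.map_comp, autCongr_comp]

/-- Isomorphisms of fields as relational structures are ring isomorphisms. -/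
def fieldLangEquivEquivRingEquiv (F K : Type) [Field F] [Field K] :
    (F ≃[fieldLang] K) ≃ (F ≃+* K) where
  toFun σ :=
    { σ.toEquiv with
      map_add' x y :=
        ((σ.map_rel (FieldRel.add : fieldLang.Relations 3) ![x, y, x + y]).2 rfl).symm
      map_mul' x y :=
        ((σ.map_rel (FieldRel.mul : fieldLang.Relations 3) ![x, y, x * y]).2 rfl).symm }
  invFun σ :=
    { σ.toEquiv with
      map_fun' f := isEmptyElim f
      map_rel' R x := by
        cases R
        · change σ (x 0) + σ (x 1) = σ (x 2) ↔ x 0 + x 1 = x 2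
          rw [← map_add, σ.injective.eq_iff]
        · change σ (x 0) * σ (x 1) = σ (x 2) ↔ x 0 * x 1 = x 2
          rw [← map_mul, σ.injective.eq_iff] }
  left_inv _ := rfl
  right_inv _ := rfl

/-- Isomorphisms of groups as relational structures are group isomorphisms. -/
def groupLangEquivEquivMulEquiv (G H : Type) [Group G] [Group H] :
    (G ≃[groupLang] H) ≃ (G ≃* H) where
  toFun σ :=
    { σ.toEquiv with
      map_mul' x y :=
        ((σ.map_rel (GroupRel.mul : groupLang.Relations 3) ![x, y, x * y]).2 rfl).symm }
  invFun σ :=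
    { σ.toEquiv with
      map_fun' f := isEmptyElim f
      map_rel' R x := by
        cases R
        change σ (x 0) * σ (x 1) = σ (x 2) ↔ x 0 * x 1 = x 2
        rw [← map_mul, σ.injective.eq_iff] }
  left_inv _ := rfl
  right_inv _ := rfl

theorem subsingleton_mulEquiv_of_effectivelyBiInterpretable {F G : Type} [Field F] [Group G]
    [Subsingleton (F ≃+* F)] (h : EffectivelyBiInterpretable fieldLang groupLang F G) :
    Subsingleton (G ≃* G) := by
  obtain ⟨e, -⟩ := h.autIsomorphic
  exact ((groupLangEquivEquivMulEquiv G G).symm.trans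
    (e.symm.trans (fieldLangEquivEquivRingEquiv F F))).subsingleton

theorem conj_ne_refl_of_not_commute {G : Type*} [Group G] {g h : G} (hgh : ¬ Commute g h) :
    MulAut.conj g ≠ MulEquiv.refl G := by
  intro hconj
  exact hgh (mul_inv_eq_iff_eq_mul.1 (DFunLike.congr_fun hconj h))

/-- The Lie bracket of the Heisenberg Lie algebra `R³`, whose third coordinate is central. -/
def heisenbergBracket {R : Type*} [CommRing R] (x y : Fin 3 → R) : Fin 3 → R :=
  ![0, 0, x 0 * y 1 - x 1 * y 0]

section HeisenbergBracket

variable {R : Type*} [CommRing R]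

theorem heisenbergBracket_swap (x y : Fin 3 → R) :
    heisenbergBracket y x = -heisenbergBracket x y := by
  ext i
  fin_cases i <;> simp [heisenbergBracket, mul_comm]

theorem linearCombination_heisenbergBracket (x y v w : Fin 3 → R) :
    Fintype.linearCombination R ![x, y, heisenbergBracket x y] (heisenbergBracket v w) =
      heisenbergBracket (Fintype.linearCombination R ![x, y, heisenbergBracket x y] v)
        (Fintype.linearCombination R ![x, y, heisenbergBracket x y] w) := by
  ext i
  fin_cases i
  · simp [heisenbergBracket, Fintype.linearCombination_apply, Fin.sum_univ_three]
  · simp [heisenbergBracket, Fintype.linearCombination_apply, Fin.sum_univ_three]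
  · simp only [heisenbergBracket, Fintype.linearCombination_apply, Fin.sum_univ_three,
      Pi.add_apply, Pi.smul_apply, smul_eq_mul, Fin.reduceFinMk, Matrix.cons_val]
    ring

theorem linearIndependent_heisenbergBracket {F : Type*} [Field F] {x y : Fin 3 → F}
    (h : heisenbergBracket x y ≠ 0) : LinearIndependent F ![x, y, heisenbergBracket x y] := by
  have hdet : (Matrix.of ![x, y, heisenbergBracket x y]).det =
      heisenbergBracket x y 2 * heisenbergBracket x y 2 := by
    simp only [Matrix.det_fin_three, heisenbergBracket, Matrix.of_apply, Matrix.cons_val]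
    ring
  have hne : heisenbergBracket x y 2 ≠ 0 := by
    contrapose! h
    ext i
    fin_cases i <;> first | rfl | exact h
  refine (Matrix.linearIndependent_rows_iff_isUnit (A := .of ![x, y, heisenbergBracket x y])).2 ?_
  rw [Matrix.isUnit_iff_isUnit_det, hdet]
  exact (mul_ne_zero hne hne).isUnit

end HeisenbergBracket

namespace Heisenberg

variable {F : Type} [Field F]

/-- The element of `H(F)` with the given entries above the diagonal. -/
def mk (a b c : F) : Heisenberg F :=
  ⟨.mkOfDetNeZero !![1, a, c; 0, 1, b; 0, 0, 1] (by simp [Matrix.det_fin_three]), a, b, c, rfl⟩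

theorem coe_mk (a b c : F) :
    ((mk a b c : GL (Fin 3) F) : Matrix (Fin 3) (Fin 3) F) = !![1, a, c; 0, 1, b; 0, 0, 1] := rfl

theorem exists_eq_mk (g : Heisenberg F) : ∃ a b c, g = mk a b c := by
  obtain ⟨g, a, b, c, h⟩ := g
  exact ⟨a, b, c, Subtype.ext (Units.ext h)⟩

theorem mk_mul_mk (a b c a' b' c' : F) :
    mk a b c * mk a' b' c' = mk (a + a') (b + b') (c + c' + a * b') := by
  refine Subtype.ext (Units.ext ?_)
  change !![1, a, c; 0, 1, b; 0, 0, 1] * !![1, a', c'; 0, 1, b'; 0, 0, 1] =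
    !![1, a + a', c + c' + a * b'; 0, 1, b + b'; 0, 0, 1]
  ext i j
  fin_cases i <;> fin_cases j <;> simp [Matrix.mul_apply, Fin.sum_univ_three] <;> ring

theorem not_commute_mk : ¬ Commute (mk 1 0 0 : Heisenberg F) (mk 0 1 0) := by
  intro h
  have hentry := congrArg (fun g : Heisenberg F => (g : GL (Fin 3) F) 0 2) h.eq
  simp [mk_mul_mk, coe_mk] at hentry

theorem exists_mulEquiv_ne_refl :
    ∃ σ : Heisenberg F ≃* Heisenberg F, σ ≠ MulEquiv.refl (Heisenberg F) :=
  ⟨_, conj_ne_refl_of_not_commute not_commute_mk⟩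

theorem not_effectivelyBiInterpretable [Subsingleton (F ≃+* F)] :
    ¬ EffectivelyBiInterpretable fieldLang groupLang F (Heisenberg F) := by
  intro h
  obtain ⟨σ, hσ⟩ := exists_mulEquiv_ne_refl (F := F)
  have := subsingleton_mulEquiv_of_effectivelyBiInterpretable h
  exact hσ (Subsingleton.elim _ _)

/-- The matrix exponential `exp !![0, x₀, x₂; 0, 0, x₁; 0, 0, 0]`, as a parametrization of `H(F)`
by the Heisenberg Lie algebra. -/
def exp : (Fin 3 → F) ≃ Heisenberg F where
  toFun x := mk (x 0) (x 1) (x 2 + x 0 * x 1 / 2)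
  invFun g :=
    let m : Matrix (Fin 3) (Fin 3) F := (g : GL (Fin 3) F)
    ![m 0 1, m 1 2, m 0 2 - m 0 1 * m 1 2 / 2]
  left_inv x := by
    ext i
    fin_cases i <;> simp [coe_mk]
  right_inv g := by
    obtain ⟨a, b, c, rfl⟩ := exists_eq_mk g
    simp [coe_mk]

variable [NeZero (2 : F)]

/- The Baker–Campbell–Hausdorff formula; the higher terms vanish as the Lie algebra is nilpotent of
class two. -/
theorem exp_mul_exp (x y : Fin 3 → F) :
    exp x * exp y = exp (x + y + (2 : F)⁻¹ • heisenbergBracket x y) := by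
  have h2 : (2 : F) ≠ 0 := two_ne_zero
  simp only [exp, Equiv.coe_fn_mk, mk_mul_mk]
  congr 1
  · simp [heisenbergBracket]
  · simp [heisenbergBracket]
  · simp only [heisenbergBracket, Pi.add_apply, Pi.smul_apply, smul_eq_mul, Matrix.cons_val]
    field_simp
    ring

theorem heisenbergBracket_ne_zero_of_not_commute {x y : Fin 3 → F}
    (h : ¬ Commute (exp x) (exp y)) : heisenbergBracket x y ≠ 0 := by
  contrapose! h
  rw [commute_iff_eq, exp_mul_exp, exp_mul_exp, heisenbergBracket_swap x y, h, neg_zero,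
    add_comm x y]

/-- The automorphism of `H(F)` that integrates an automorphism of its Lie algebra. -/
def mulEquivOfLinearEquiv (T : (Fin 3 → F) ≃ₗ[F] (Fin 3 → F))
    (hT : ∀ x y, T (heisenbergBracket x y) = heisenbergBracket (T x) (T y)) :
    Heisenberg F ≃* Heisenberg F where
  toEquiv := exp.symm.trans (T.toEquiv.trans exp)
  map_mul' g h := by
    obtain ⟨x, rfl⟩ := exp.surjective g
    obtain ⟨y, rfl⟩ := exp.surjective h
    simp [exp_mul_exp, hT]

theorem mulEquivOfLinearEquiv_exp (T : (Fin 3 → F) ≃ₗ[F] (Fin 3 → F))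
    (hT : ∀ x y, T (heisenbergBracket x y) = heisenbergBracket (T x) (T y)) (x : Fin 3 → F) :
    mulEquivOfLinearEquiv T hT (exp x) = exp (T x) := by
  simp [mulEquivOfLinearEquiv]

theorem exists_mulEquiv_apply_exp_single {u v : Heisenberg F} (h : ¬ Commute u v) :
    ∃ σ : Heisenberg F ≃* Heisenberg F,
      σ (exp (Pi.single 0 1)) = u ∧ σ (exp (Pi.single 1 1)) = v := by
  obtain ⟨x, rfl⟩ := exp.surjective u
  obtain ⟨y, rfl⟩ := exp.surjective v
  have hindep := linearIndependent_heisenbergBracket (heisenbergBracket_ne_zero_of_not_commute h)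
  let T : (Fin 3 → F) ≃ₗ[F] (Fin 3 → F) :=
    .ofInjectiveEndo _ hindep.fintypeLinearCombination_injective
  have hT (i : Fin 3) : T (Pi.single i 1) = ![x, y, heisenbergBracket x y] i :=
    (Fintype.linearCombination_apply_single F _ i 1).trans (one_smul F _)
  let σ := mulEquivOfLinearEquiv T (linearCombination_heisenbergBracket x y)
  have hσ (i : Fin 3) : σ (exp (Pi.single i 1)) = exp (![x, y, heisenbergBracket x y] i) :=
    (mulEquivOfLinearEquiv_exp T _ _).trans (congrArg exp (hT i))
  exact ⟨σ, hσ 0, hσ 1⟩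

theorem exists_mulEquiv_of_not_commute {u v u' v' : Heisenberg F} (h : ¬ Commute u v)
    (h' : ¬ Commute u' v') : ∃ σ : Heisenberg F ≃* Heisenberg F, σ u = u' ∧ σ v = v' := by
  obtain ⟨σ, rfl, rfl⟩ := exists_mulEquiv_apply_exp_single h
  obtain ⟨τ, rfl, rfl⟩ := exists_mulEquiv_apply_exp_single h'
  exact ⟨σ.symm.trans τ, by simp, by simp⟩

end Heisenberg

instance subsingleton_rat_ringEquiv {R : Type*} [Semiring R] : Subsingleton (ℚ ≃+* R) where
  allEq σ τ := RingEquiv.ext fun x =>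
    DFunLike.congr_fun (Subsingleton.elim (σ : ℚ →+* R) τ) x

theorem not_uniformlyEffectivelyBiInterpretableHeisenberg :
    ¬ UniformlyEffectivelyBiInterpretableHeisenberg := by
  rintro ⟨I, J, Φ, Ψ, h⟩
  exact Heisenberg.not_effectivelyBiInterpretable ⟨I, J, Φ, Ψ, h ℚ⟩

theorem mainTheorem9_general :
    ¬ UniformlyEffectivelyBiInterpretableHeisenberg ∧
    (∀ (F : Type) [Field F] [Subsingleton (F ≃+* F)],
      ¬ EffectivelyBiInterpretable fieldLang groupLang F (Heisenberg F)) ∧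
    (∀ σ : ℚ ≃+* ℚ, σ = RingEquiv.refl ℚ) ∧
    (∀ (F : Type) [Field F],
      ∃ σ : Heisenberg F ≃* Heisenberg F, σ ≠ MulEquiv.refl (Heisenberg F)) ∧
    (∀ (F : Type) [Field F] [NeZero (2 : F)] (u v u' v' : Heisenberg F),
      ¬ Commute u v → ¬ Commute u' v' →
        ∃ σ : Heisenberg F ≃* Heisenberg F, σ u = u' ∧ σ v = v') ∧
    (∀ (L L' : FirstOrder.Language.{0, 0}) [ComputableLanguage L] [ComputableLanguage L']
      (A B : Type) [L.Structure A] [L'.Structure B],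
      EffectivelyBiInterpretable L L' A B → AutIsomorphic L L' A B) :=
  ⟨not_uniformlyEffectivelyBiInterpretableHeisenberg,
    fun _ _ _ => Heisenberg.not_effectivelyBiInterpretable, fun σ => Subsingleton.elim σ _,
    fun _ _ => Heisenberg.exists_mulEquiv_ne_refl,
    fun _ _ _ _ _ _ _ => Heisenberg.exists_mulEquiv_of_not_commute,
    fun _ _ _ _ _ _ _ _ => EffectivelyBiInterpretable.autIsomorphic⟩

theorem mainTheorem9 :
    ¬ UniformlyEffectivelyBiInterpretableHeisenberg ∧
    ¬ EffectivelyBiInterpretable fieldLang groupLang ℚ (Heisenberg ℚ) ∧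
    (∀ σ : ℚ ≃+* ℚ, σ = RingEquiv.refl ℚ) ∧
    (∃ σ : Heisenberg ℚ ≃* Heisenberg ℚ, σ ≠ MulEquiv.refl (Heisenberg ℚ)) ∧
    (∀ u v : Heisenberg ℚ, u * v ≠ v * u →
      ∃ σ : Heisenberg ℚ ≃* Heisenberg ℚ, σ u = v ∧ σ v = u) ∧
    (∀ (L L' : FirstOrder.Language.{0, 0}) [ComputableLanguage L] [ComputableLanguage L']
      (A B : Type) [L.Structure A] [L'.Structure B],
      EffectivelyBiInterpretable L L' A B → AutIsomorphic L L' A B) := by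
  obtain ⟨huniform, hfield, hrat, hne, hpairs, haut⟩ := mainTheorem9_general
  exact ⟨huniform, hfield ℚ, hrat, hne ℚ, fun u v h => hpairs ℚ u v v u h (h ·.symm), haut⟩
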